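/- For each integer $n\ge 1$ let $p=p(n)$ be an integer with $1\le p(n)\le n$, and suppose that $n-p(n)\to\infty$ as $n\to\infty$. Let $X_1,\dots,X_{n+1}$ be independent observations from the Gaussian distribution $\mathcal N_p(\mu,\Sigma)$ on $\mathbb R^p$, where $\Sigma$ is an unknown positive definite matrix and the mean $\mu$ is known only to belong to a given nonempty set $M_n\subseteq\mathbb R^{p}$ (for instance $M_n=\mathbb R^p$ for an unknown mean, or $M_n=\{\mu_n\}$ for a fixed mean). Let $$R_n=\inf_{\delta}\ \sup_{\mu\in M_n,\ \Sigma\succ 0}\ \mathbb E_{\mu,\Sigma}\big(\delta-\log\det\Sigma\big)^2\in[0,\infty]$$ be the minimax risk for estimating $\log\det\Sigma$, the infimum being over all measurable functions $\delta=\delta(X_1,\dots,X_{n+1})$ with real values. Then, in $[0,\infty]$, $$2\liminf_{n\to\infty}\frac{p(n)}n\ \le\ \liminf_{n\to\infty}R_n\ \le\ \limsup_{n\to\infty}R_n\ \le\ \limsup_{n\to\infty}\Big(-2\log\Big(1-\frac{p(n)}n\Big)\Big).$$ In particular, if $p(n)/n\to 0$, then $$\lim_{n\to\infty}\frac{n}{p(n)}\,R_n=2,$$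 and the estimator $$\hat T_n=\log\det\hat\Sigma-\sum_{k=1}^{p}\Big[\psi\Big(\frac{n-k+1}2\Big)-\log\frac n2\Big],\qquad \hat\Sigma=\frac1n\sum_{k=1}^{n+1}(X_k-\bar X)(X_k-\bar X)^T,\quad \bar X=\frac1{n+1}\sum_{k=1}^{n+1}X_k,$$ where $\psi=(\log\Gamma)'$ is the digamma function, is asymptotically sharp minimax: the ratio $\sup_{\mu\in M_n,\,\Sigma\succ0}\mathbb E_{\mu,\Sigma}(\hat T_n-\log\det\Sigma)^2/R_n$ tends to $1$. (When $\det\hat\Sigma=0$, an event of probability zero, $\hat T_n$ is given by the convention $\log 0=0$.) -/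

import Mathlib

open Filter Topology MeasureTheory ProbabilityTheory
open scoped ENNReal

noncomputable section

namespace LogDet

/-- A sample `X₁, …, X_{n+1}` of `n + 1` vectors in `ℝᵖ`. -/
abbrev Sample (n p : ℕ) : Type := Fin (n + 1) → EuclideanSpace ℝ (Fin p)

/-- The joint law of `n + 1` independent observations from `N_p(μ, S)`. -/
def sampleLaw (n p : ℕ) (μ : EuclideanSpace ℝ (Fin p)) (S : Matrix (Fin p) (Fin p) ℝ) :
    Measure (Sample n p) :=
  Measure.pi (fun _ : Fin (n + 1) => multivariateGaussian μ S)

/-- The sample mean of `n + 1` observations. -/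
def sampleMean {n p : ℕ} (x : Sample n p) : EuclideanSpace ℝ (Fin p) :=
  ((n : ℝ) + 1)⁻¹ • ∑ k, x k

/-- The sample covariance matrix `(1/n) ∑ₖ (Xₖ - X̄)(Xₖ - X̄)ᵀ` of `n + 1` observations. -/
def sampleCov {n p : ℕ} (x : Sample n p) : Matrix (Fin p) (Fin p) ℝ :=
  (n : ℝ)⁻¹ • ∑ k, Matrix.of fun i j =>
    (x k i - sampleMean x i) * (x k j - sampleMean x j)

/-- The digamma function, as the derivative of `log Γ`. -/
def digamma (x : ℝ) : ℝ := deriv (fun z : ℝ => Real.log (Real.Gamma z)) x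

/-- The bias correction `∑_{k=1}^p [ψ((n - k + 1)/2) - log (n/2)]`. -/
def tau (n p : ℕ) : ℝ :=
  ∑ k ∈ Finset.Icc 1 p, (digamma (((n : ℝ) - k + 1) / 2) - Real.log ((n : ℝ) / 2))

/-- The bias-corrected log-determinant of the sample covariance matrix. -/
def estimator (n p : ℕ) (x : Sample n p) : ℝ :=
  Real.log (sampleCov x).det - tau n p

/-- The mean squared error of `δ` for `log det S` under `N_p(μ, S)`, with values in `[0, ∞]`. -/
def risk {n p : ℕ} (δ : Sample n p → ℝ) (μ : EuclideanSpace ℝ (Fin p))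
    (S : Matrix (Fin p) (Fin p) ℝ) : ℝ≥0∞ :=
  ∫⁻ x, ENNReal.ofReal ((δ x - Real.log S.det) ^ 2) ∂(sampleLaw n p μ S)

/-- The maximal risk of `δ` over all means in `M` and all positive definite covariances. -/
def maxRisk {n p : ℕ} (M : Set (EuclideanSpace ℝ (Fin p))) (δ : Sample n p → ℝ) : ℝ≥0∞ :=
  ⨆ μ ∈ M, ⨆ (S : Matrix (Fin p) (Fin p) ℝ) (_ : S.PosDef), risk δ μ S

/-- The minimax risk: the infimum of the maximal risk over all measurable estimators. -/
def minimaxRisk (n p : ℕ) (M : Set (EuclideanSpace ℝ (Fin p))) : ℝ≥0∞ :=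
  ⨅ (δ : Sample n p → ℝ) (_ : Measurable δ), maxRisk M δ

/-- A sequence of (measurable) estimators is asymptotically sharp minimax if the ratio of its
maximal risk to the minimax risk tends to `1`. -/
def IsAsymptoticallySharpMinimax (p : ℕ → ℕ) (M : ∀ n, Set (EuclideanSpace ℝ (Fin (p n))))
    (δ : ∀ n, Sample n (p n) → ℝ) : Prop :=
  (∀ n, Measurable (δ n)) ∧
    Tendsto (fun n => maxRisk (M n) (δ n) / minimaxRisk n (p n) (M n)) atTop (𝓝 1)

end LogDet

end

/-! The upper bounds come from an exact description of the law of the estimator. Affine equivariance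
of the sample covariance cancels the mean and turns `S` into a factor `S.det`, so the error of the
estimator has the same law for all parameters. After transposition and centring, the determinant for
standard data is that of the Gram matrix of `p` independent standard Gaussian vectors in an
`n`-dimensional space. Splitting off one vector at a time makes it a product of independent
chi-squared variables with `n, n-1, …, n-p+1` degrees of freedom (`lintegral_det_gram`). The
correction `tau` is the exact mean of the logarithm, so the risk is a sum of variances of log-Gamma
variables, each at most `1/(a-1)` for shape `a > 1` (`variance_log_gammaMeasure_le`).

The lower bound is a Bayes risk. Fix one mean in `M`, restrict to covariances `s⁻¹ • 1`, and give
`s` a standard exponential prior. By conjugacy the posterior of `s` is a Gamma law of shape `a =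
(n+1)p/2 + 1`, whatever the data (`lintegral_bayes`). The target is `-p log s`, and a Cramér–Rao
type inequality bounds the mean square of log Gamma about any centre below by `1/a`; hence the
minimax risk is at least `p²/a ≥ 2p/(n+3)` (`le_minimaxRisk`).

Comparing these bounds gives all the limits. -/

namespace LogDet

open Set Real

/-! ### Moments and logarithmic moments of Gamma laws. -/

section GammaMeasure

variable {a r : ℝ}

theorem ae_pos_gammaMeasure (a r : ℝ) : ∀ᵐ x ∂(gammaMeasure a r), 0 < x := by
  rw [gammaMeasure, ae_withDensity_iff' (by unfold gammaPDF; fun_prop)]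
  have h0 : ∀ᵐ x : ℝ, x ≠ 0 := by simp [ae_iff]
  filter_upwards [h0] with x hx h
  by_contra hneg
  exact h (gammaPDF_of_neg (lt_of_le_of_ne (not_lt.mp hneg) hx))

theorem measurable_gammaPDF (a r : ℝ) : Measurable (gammaPDF a r) := by
  unfold gammaPDF; fun_prop

theorem lintegral_gammaMeasure (a r : ℝ) (f : ℝ → ℝ≥0∞) :
    ∫⁻ x, f x ∂(gammaMeasure a r) = ∫⁻ x in Ioi 0,
      ENNReal.ofReal (r ^ a / Gamma a * x ^ (a - 1) * exp (-(r * x))) * f x := by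
  rw [gammaMeasure, lintegral_withDensity_eq_lintegral_mul_non_measurable _
    (measurable_gammaPDF a r) (by simp [gammaPDF]), ← lintegral_indicator measurableSet_Ioi]
  apply lintegral_congr_ae
  have h0 : ∀ᵐ x : ℝ, x ≠ 0 := by simp [ae_iff]
  filter_upwards [h0] with x hx
  rcases lt_or_gt_of_ne hx with h | h
  · simp [gammaPDF_of_neg h, Set.indicator, h.le]
  · simp [gammaPDF_of_nonneg h.le, Set.indicator, h]

theorem integral_gammaMeasure (ha : 0 < a) (hr : 0 < r) (f : ℝ → ℝ) :
    ∫ x, f x ∂(gammaMeasure a r) =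
      ∫ x in Ioi 0, (r ^ a / Gamma a * x ^ (a - 1) * exp (-(r * x))) * f x := by
  rw [gammaMeasure, integral_withDensity_eq_integral_toReal_smul (measurable_gammaPDF a r)
    (by simp [gammaPDF]), ← integral_indicator measurableSet_Ioi]
  apply integral_congr_ae
  have h0 : ∀ᵐ x : ℝ, x ≠ 0 := by simp [ae_iff]
  filter_upwards [h0] with x hx
  rcases lt_or_gt_of_ne hx with h | h
  · simp [gammaPDF_of_neg h, Set.indicator, h.le]
  · have := Gamma_pos_of_pos ha
    rw [gammaPDF_of_nonneg h.le, ENNReal.toReal_ofReal (by positivity)]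
    simp [Set.indicator, h]

theorem integrable_gammaMeasure_iff (ha : 0 < a) (hr : 0 < r) (f : ℝ → ℝ) :
    Integrable f (gammaMeasure a r) ↔
      IntegrableOn (fun x => (r ^ a / Gamma a * x ^ (a - 1) * exp (-(r * x))) * f x) (Ioi 0) := by
  rw [gammaMeasure, integrable_withDensity_iff_integrable_smul' (measurable_gammaPDF a r)
    (by simp [gammaPDF]), ← integrable_indicator_iff measurableSet_Ioi]
  apply integrable_congr
  have h0 : ∀ᵐ x : ℝ, x ≠ 0 := by simp [ae_iff]
  filter_upwards [h0] with x hx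
  rcases lt_or_gt_of_ne hx with h | h
  · simp [gammaPDF_of_neg h, Set.indicator, h.le]
  · have := Gamma_pos_of_pos ha
    rw [gammaPDF_of_nonneg h.le, ENNReal.toReal_ofReal (by positivity)]
    simp [Set.indicator, h]

/-- Size-biasing raises the shape by one, because `Γ(a+1) = aΓ(a)`. This shift supplies the moments
of `x`, `x²` and `x log x`, and, started from shape `a - 1`, that of `x⁻¹`. -/
theorem gamma_density_mul_self (ha : 0 < a) (hr : 0 < r) {x : ℝ} (hx : 0 < x) (y : ℝ) :
    (r ^ a / Gamma a * x ^ (a - 1) * exp (-(r * x))) * (x * y) =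
      (a / r) * ((r ^ (a + 1) / Gamma (a + 1) * x ^ (a + 1 - 1) * exp (-(r * x))) * y) := by
  have := Gamma_pos_of_pos ha
  rw [Gamma_add_one ha.ne', rpow_add_one hr.ne', add_sub_cancel_right, rpow_sub_one hx.ne']
  field_simp

theorem integral_id_mul_gammaMeasure (ha : 0 < a) (hr : 0 < r) (f : ℝ → ℝ) :
    ∫ x, x * f x ∂(gammaMeasure a r) = (a / r) * ∫ x, f x ∂(gammaMeasure (a + 1) r) := by
  rw [integral_gammaMeasure ha hr, integral_gammaMeasure (by positivity) hr,
    ← integral_const_mul]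
  exact setIntegral_congr_fun measurableSet_Ioi fun x hx => gamma_density_mul_self ha hr hx _

theorem integrable_id_mul_gammaMeasure_iff (ha : 0 < a) (hr : 0 < r) (f : ℝ → ℝ) :
    Integrable (fun x => x * f x) (gammaMeasure a r) ↔ Integrable f (gammaMeasure (a + 1) r) := by
  rw [integrable_gammaMeasure_iff ha hr, integrable_gammaMeasure_iff (by positivity) hr]
  rw [integrableOn_congr_fun (s := Ioi 0)
    (fun x hx => gamma_density_mul_self ha hr hx (f x)) measurableSet_Ioi]
  exact integrable_const_mul_iff (IsUnit.mk0 _ (by positivity)) _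

theorem integrable_id_gammaMeasure (ha : 0 < a) (hr : 0 < r) :
    Integrable (fun x => x) (gammaMeasure a r) := by
  have := isProbabilityMeasure_gammaMeasure (a := a + 1) (by positivity) hr
  simpa using (integrable_id_mul_gammaMeasure_iff ha hr (fun _ => 1)).2 (integrable_const _)

theorem integral_id_gammaMeasure (ha : 0 < a) (hr : 0 < r) :
    ∫ x, x ∂(gammaMeasure a r) = a / r := by
  have := isProbabilityMeasure_gammaMeasure (a := a + 1) (by positivity) hr
  simpa using integral_id_mul_gammaMeasure ha hr (fun _ => 1)

theorem integrable_inv_gammaMeasure (ha : 1 < a) (hr : 0 < r) :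
    Integrable (fun x => x⁻¹) (gammaMeasure a r) := by
  have ha' : 0 < a - 1 := by linarith
  have := isProbabilityMeasure_gammaMeasure ha' hr
  have h := (integrable_id_mul_gammaMeasure_iff ha' hr (fun x => x⁻¹)).1 ?_
  · simpa using h
  · refine (integrable_const (1 : ℝ)).congr ?_
    filter_upwards [ae_pos_gammaMeasure (a - 1) r] with x hx
    field_simp

theorem integral_inv_gammaMeasure (ha : 1 < a) (hr : 0 < r) :
    ∫ x, x⁻¹ ∂(gammaMeasure a r) = r / (a - 1) := by
  have ha' : 0 < a - 1 := by linarith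
  have := isProbabilityMeasure_gammaMeasure ha' hr
  have h := integral_id_mul_gammaMeasure ha' hr (fun x => x⁻¹)
  have h1 : ∫ x, x * x⁻¹ ∂(gammaMeasure (a - 1) r) = 1 := by
    rw [integral_congr_ae (g := fun _ => (1 : ℝ))]
    · simp
    · filter_upwards [ae_pos_gammaMeasure (a - 1) r] with x hx
      field_simp
  rw [h1, sub_add_cancel] at h
  field_simp at h ⊢
  linarith

/-- The elementary bound `log² u ≤ u - 2 + 1 / u`. -/
theorem sq_log_le {u : ℝ} (hu : 0 < u) : (log u) ^ 2 ≤ u - 2 + u⁻¹ := by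
  have hx : (log u) ^ 2 ≤ 4 * sinh (log u / 2) ^ 2 := by
    have h : |log u / 2| ≤ |sinh (log u / 2)| := by
      rw [abs_sinh]
      exact self_le_sinh_iff.2 (abs_nonneg _)
    have := sq_le_sq.2 h
    linarith
  have h2 : cosh (log u) = 2 * sinh (log u / 2) ^ 2 + 1 := by
    have := cosh_two_mul (log u / 2)
    rw [mul_div_cancel₀ _ two_ne_zero, cosh_sq] at this
    linarith
  have h3 : cosh (log u) = (u + u⁻¹) / 2 := cosh_log hu
  linarith

theorem sq_log_div_le (ha : 0 < a) {x : ℝ} (hx : 0 < x) :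
    (log x - log a) ^ 2 ≤ x * a⁻¹ - 2 + a * x⁻¹ := by
  have := sq_log_le (div_pos hx ha)
  rwa [log_div hx.ne' ha.ne', div_eq_mul_inv, mul_inv_rev, inv_inv] at this

theorem integrable_sq_log_bound (ha : 1 < a) :
    Integrable (fun x => x * a⁻¹ - 2 + a * x⁻¹) (gammaMeasure a 1) := by
  have := isProbabilityMeasure_gammaMeasure (a := a) (by linarith) one_pos
  exact (((integrable_id_gammaMeasure (by linarith) one_pos).mul_const _).sub
    (integrable_const _)).add ((integrable_inv_gammaMeasure ha one_pos).const_mul _)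

theorem memLp_log_gammaMeasure (ha : 1 < a) : MemLp log 2 (gammaMeasure a 1) := by
  have := isProbabilityMeasure_gammaMeasure (a := a) (by linarith) one_pos
  have h : MemLp (fun x => log x - log a) 2 (gammaMeasure a 1) := by
    rw [memLp_two_iff_integrable_sq (by fun_prop)]
    refine (integrable_sq_log_bound ha).mono' (by fun_prop) ?_
    filter_upwards [ae_pos_gammaMeasure a 1] with x hx
    rw [norm_of_nonneg (sq_nonneg _)]
    exact sq_log_div_le (by linarith) hx
  convert! h.add (memLp_const (log a)) using 1
  ext x
  simp

/-- Centring at `log a` instead of the true mean only increases the second moment. Then `sq_log_le`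
with `u = x / a` has expectation `1 - 2 + a/(a-1)`. -/
theorem variance_log_gammaMeasure_le (ha : 1 < a) :
    Var[log; gammaMeasure a 1] ≤ 1 / (a - 1) := by
  have := isProbabilityMeasure_gammaMeasure (a := a) (by linarith) one_pos
  have h1 : Var[log; gammaMeasure a 1] = Var[fun x => log x - log a; gammaMeasure a 1] :=
    (variance_sub_const (by fun_prop) _).symm
  rw [h1]
  refine (variance_le_expectation_sq (by fun_prop)).trans ?_
  have hi := integrable_sq_log_bound ha
  calc ∫ x, ((fun x => log x - log a) ^ 2) x ∂(gammaMeasure a 1)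
      ≤ ∫ x, (x * a⁻¹ - 2 + a * x⁻¹) ∂(gammaMeasure a 1) := by
        refine integral_mono_of_nonneg (ae_of_all _ fun x => ?_) hi ?_
        · simp only [Pi.pow_apply, Pi.zero_apply]; positivity
        · filter_upwards [ae_pos_gammaMeasure a 1] with x hx
          exact sq_log_div_le (by linarith) hx
    _ = 1 / (a - 1) := by
        have hx := (integrable_id_gammaMeasure (a := a) (by linarith) one_pos).mul_const a⁻¹
        rw [integral_add (f := fun x => x * a⁻¹ - 2) (hx.sub (integrable_const _))
          ((integrable_inv_gammaMeasure ha one_pos).const_mul _),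
          integral_sub hx (integrable_const _), integral_mul_const, integral_const_mul,
          integral_id_gammaMeasure (by linarith) one_pos, integral_inv_gammaMeasure ha one_pos]
        have h0 : a - 1 ≠ 0 := by linarith
        have h0' : a ≠ 0 := by linarith
        simp
        field_simp
        ring

/-- `Γ` is the Mellin transform of `exp (-x)`; differentiating under the integral inserts `log x`,
so the mean of the logarithm is `Γ'(a)/Γ(a)`. -/
theorem integrable_log_gammaMeasure_and_integral (ha : 0 < a) :
    Integrable log (gammaMeasure a 1) ∧ ∫ x, log x ∂(gammaMeasure a 1) = digamma a := by
  have hs : 0 < (a : ℂ).re := by simpa using ha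
  -- Boundedness at `0` (exponent `0`) and decay faster than `x ^ (-(a+1))` at infinity give
  -- differentiability for real part in `(0, a+1)`, a strip containing `a`.
  have hm := mellin_hasDerivAt_of_isBigO_rpow (E := ℂ) (f := fun x : ℝ => (rexp (-x) : ℂ))
    (s := (a : ℂ)) (a := a + 1) (b := 0)
    ((Continuous.continuousOn (by fun_prop)).locallyIntegrableOn measurableSet_Ioi)
    (by
      rw [← Asymptotics.isBigO_norm_left]
      simp_rw [Complex.norm_real, Asymptotics.isBigO_norm_left]
      simpa only [neg_one_mul] using (isLittleO_exp_neg_mul_rpow_atTop zero_lt_one _).isBigO)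
    (by simp)
    (by
      simp_rw [neg_zero, rpow_zero]
      refine Asymptotics.isBigO_const_of_tendsto (?_ : Tendsto _ _ (𝓝 (1 : ℂ))) one_ne_zero
      rw [(by simp : (1 : ℂ) = Real.exp (-0))]
      exact (by fun_prop : Continuous fun x : ℝ => (rexp (-x) : ℂ)).continuousWithinAt)
    hs
  have key : ∀ x ∈ Ioi (0 : ℝ), (x : ℂ) ^ ((a : ℂ) - 1) • (log x • (rexp (-x) : ℂ)) =
      ((x ^ (a - 1) * exp (-x) * log x : ℝ) : ℂ) := by
    intro x hx
    have hx' : (0 : ℝ) ≤ x := le_of_lt hx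
    rw [show (a : ℂ) - 1 = ((a - 1 : ℝ) : ℂ) by simp, ← Complex.ofReal_cpow hx']
    simp only [smul_eq_mul, Complex.real_smul]
    push_cast
    ring
  have hi : IntegrableOn (fun x => x ^ (a - 1) * exp (-x) * log x) (Ioi 0) := by
    have h1 := hm.1
    unfold MellinConvergent at h1
    rw [integrableOn_congr_fun key measurableSet_Ioi] at h1
    have h2 := h1.re
    simp only [RCLike.re_eq_complex_re, Complex.ofReal_re] at h2
    exact h2
  have hderiv : HasDerivAt Gamma (∫ x in Ioi 0, x ^ (a - 1) * exp (-x) * log x) a := by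
    have h2 := hm.2
    unfold mellin at h2
    rw [setIntegral_congr_fun measurableSet_Ioi key, integral_complex_ofReal] at h2
    have h3 : HasDerivAt Complex.Gamma
        ((∫ x in Ioi 0, x ^ (a - 1) * exp (-x) * log x : ℝ) : ℂ) (a : ℂ) := by
      refine h2.congr_of_eventuallyEq ?_
      have : IsOpen {s : ℂ | 0 < s.re} := Complex.continuous_re.isOpen_preimage _ isOpen_Ioi
      filter_upwards [this.mem_nhds hs] with z hz
      rw [Complex.Gamma_eq_integral hz, Complex.GammaIntegral_eq_mellin, mellin]
    simpa [Complex.Gamma_ofReal] using h3.real_of_complex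
  have hG := Gamma_pos_of_pos ha
  have hdig : digamma a = (∫ x in Ioi 0, x ^ (a - 1) * exp (-x) * log x) / Gamma a :=
    (hderiv.log hG.ne').deriv
  have hfun : (fun x => (1 ^ a / Gamma a * x ^ (a - 1) * exp (-(1 * x))) * log x) =
      fun x => (Gamma a)⁻¹ * (x ^ (a - 1) * exp (-x) * log x) := by
    ext x; rw [one_rpow, one_mul]; ring
  refine ⟨?_, ?_⟩
  · rw [integrable_gammaMeasure_iff ha one_pos, hfun]
    exact hi.const_mul _
  · rw [integral_gammaMeasure ha one_pos, hfun, integral_const_mul, hdig]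
    ring

theorem integrable_log_gammaMeasure (ha : 0 < a) : Integrable log (gammaMeasure a 1) :=
  (integrable_log_gammaMeasure_and_integral ha).1

theorem integral_log_gammaMeasure (ha : 0 < a) :
    ∫ x, log x ∂(gammaMeasure a 1) = digamma a :=
  (integrable_log_gammaMeasure_and_integral ha).2

theorem digamma_add_one (ha : 0 < a) : digamma (a + 1) = digamma a + 1 / a := by
  have hd : DifferentiableAt ℝ (fun z => log (Gamma z)) a :=
    (differentiableAt_Gamma fun m => by have : (0 : ℝ) ≤ m := m.cast_nonneg; linarith).log
      (Gamma_pos_of_pos ha).ne'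
  unfold digamma
  rw [← deriv_comp_add_const, one_div, ← Real.deriv_log a, add_comm,
    ← deriv_add (differentiableAt_log ha.ne') hd]
  apply Filter.EventuallyEq.deriv_eq
  filter_upwards [lt_mem_nhds ha] with z hz
  simp [Gamma_add_one hz.ne', log_mul hz.ne' (Gamma_pos_of_pos hz).ne']

/-- A Cramér–Rao type lower bound for the mean squared logarithm of a Gamma variable. -/
theorem one_div_le_integral_sq_log_gammaMeasure (ha : 1 < a) (c : ℝ) :
    1 / a ≤ ∫ x, (log x + c) ^ 2 ∂(gammaMeasure a 1) := by
  have ha0 : 0 < a := by linarith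
  have := isProbabilityMeasure_gammaMeasure ha0 one_pos
  have := isProbabilityMeasure_gammaMeasure (a := a + 1) (by positivity) one_pos
  have hL : MemLp (fun x => log x + c) 2 (gammaMeasure a 1) :=
    (memLp_log_gammaMeasure ha).add (memLp_const c)
  have hL1 : Integrable (fun x => log x + c) (gammaMeasure a 1) := hL.integrable (by norm_num)
  have hL2 : Integrable (fun x => log x + c) (gammaMeasure (a + 1) 1) :=
    (integrable_log_gammaMeasure (by positivity)).add (integrable_const c)
  have hxL : Integrable (fun x => x * (log x + c)) (gammaMeasure a 1) :=
    (integrable_id_mul_gammaMeasure_iff ha0 one_pos _).2 hL2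
  have hx := integrable_id_gammaMeasure ha0 one_pos
  have hx2 : Integrable (fun x => x * x) (gammaMeasure a 1) :=
    (integrable_id_mul_gammaMeasure_iff ha0 one_pos _).2
      (integrable_id_gammaMeasure (by positivity) one_pos)
  have hA : Integrable (fun x => (2 / a) * (x * (log x + c)) - 2 * (log x + c))
    (gammaMeasure a 1) := (hxL.const_mul _).sub (hL1.const_mul _)
  have hB : Integrable (fun x => (1 / a ^ 2) * (x * x) - (2 / a) * x) (gammaMeasure a 1) :=
    (hx2.const_mul _).sub (hx.const_mul _)
  have hC : Integrable (fun x => (1 / a ^ 2) * (x * x) - (2 / a) * x + 1) (gammaMeasure a 1) :=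
    hB.add (integrable_const 1)
  have hlow : Integrable (fun x => (2 / a) * (x * (log x + c)) - 2 * (log x + c) -
      ((1 / a ^ 2) * (x * x) - (2 / a) * x + 1)) (gammaMeasure a 1) :=
    hA.sub hC
  -- With `L = log x + c` and `T = x/a - 1` (the scale score divided by `a`), this is `E[2LT - T²]`.
  -- Here `E[LT] = digamma (a+1) - digamma a = 1/a`, independent of `c`, and `E[T²] = 1/a`. The
  -- conclusion is then `(L - T)² ≥ 0`.
  have hval : ∫ x, ((2 / a) * (x * (log x + c)) - 2 * (log x + c) -
      ((1 / a ^ 2) * (x * x) - (2 / a) * x + 1)) ∂(gammaMeasure a 1) = 1 / a := by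
    rw [integral_sub hA hC,
      integral_sub (hxL.const_mul _) (hL1.const_mul _),
      integral_add hB (integrable_const 1),
      integral_sub (hx2.const_mul _) (hx.const_mul _)]
    simp_rw [integral_const_mul]
    rw [integral_const_mul (2 / a) (fun x => x)]
    rw [integral_id_mul_gammaMeasure ha0 one_pos, integral_id_mul_gammaMeasure ha0 one_pos,
      integral_id_gammaMeasure ha0 one_pos, integral_id_gammaMeasure (by positivity) one_pos,
      integral_add (integrable_log_gammaMeasure (by positivity)) (integrable_const c),
      integral_add (integrable_log_gammaMeasure (by positivity)) (integrable_const c),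
      integral_log_gammaMeasure ha0, integral_log_gammaMeasure (by positivity),
      digamma_add_one ha0]
    simp
    field_simp
    ring
  rw [← hval]
  refine integral_mono hlow hL.integrable_sq fun x => ?_
  have h := sq_nonneg ((log x + c) - (x / a - 1))
  have h1 : (x / a - 1) ^ 2 = (1 / a ^ 2) * (x * x) - (2 / a) * x + 1 := by field_simp; ring
  have h2 : 2 * (log x + c) * (x / a - 1) =
    (2 / a) * (x * (log x + c)) - 2 * (log x + c) := by field_simp
  simp only
  nlinarith

end GammaMeasure

end LogDet

namespace LogDet

open Set Real Module

/-! ### Standard Gaussian measures: density, norm, projections, products. -/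

section StdGaussian

variable {V : Type*} [NormedAddCommGroup V] [InnerProductSpace ℝ V] [FiniteDimensional ℝ V]
  [MeasurableSpace V] [BorelSpace V]

/-- The normalising constant of the standard Gaussian density in dimension `d`. -/
noncomputable def gaussConst (d : ℕ) : ℝ := ((2 * π) ^ ((d : ℝ) / 2))⁻¹

theorem gaussConst_pos (d : ℕ) : 0 < gaussConst d := by
  unfold gaussConst; positivity

/-- The standard Gaussian density on a Euclidean space. -/
noncomputable def gaussDensity (V : Type*) [NormedAddCommGroup V] [InnerProductSpace ℝ V] (x : V) : ℝ :=
  gaussConst (finrank ℝ V) * exp (-‖x‖ ^ 2 / 2)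

omit [FiniteDimensional ℝ V] [MeasurableSpace V] [BorelSpace V] in
theorem gaussDensity_nonneg (x : V) : 0 ≤ gaussDensity V x :=
  mul_nonneg (gaussConst_pos _).le (exp_pos _).le

omit [FiniteDimensional ℝ V] in
theorem measurable_gaussDensity : Measurable (gaussDensity V) := by
  unfold gaussDensity; fun_prop

theorem integrable_gaussDensity : Integrable (gaussDensity V) := by
  have h := (GaussianFourier.integrable_cexp_neg_mul_sq_norm_add (b := 1 / 2) (by simp) 0
    (0 : V)).norm
  refine (h.congr (ae_of_all _ fun x => ?_)).const_mul _
  simp only [zero_mul, add_zero, Complex.norm_exp]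
  congr 1
  rw [show -(1 / 2 : ℂ) * (‖x‖ : ℂ) ^ 2 = ((-‖x‖ ^ 2 / 2 : ℝ) : ℂ) by push_cast; ring,
    Complex.ofReal_re]

/-- Both finite measures have the same characteristic function. The explicit density is what polar
coordinates and Bayes' formula act on. -/
theorem stdGaussian_eq_withDensity :
    stdGaussian V = volume.withDensity (fun x => ENNReal.ofReal (gaussDensity V x)) := by
  have hfin : IsFiniteMeasure
      ((volume : Measure V).withDensity (fun x => ENNReal.ofReal (gaussDensity V x))) :=
    isFiniteMeasure_withDensity_ofReal integrable_gaussDensity.2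
  apply Measure.ext_of_charFun
  ext t
  rw [charFun_stdGaussian, charFun_apply, integral_withDensity_eq_integral_toReal_smul
    measurable_gaussDensity.ennreal_ofReal (by simp)]
  have h := GaussianFourier.integral_cexp_neg_mul_sq_norm_add (b := 1 / 2) (by simp) Complex.I t
  have : ∀ x : V, (ENNReal.ofReal (gaussDensity V x)).toReal •
      Complex.exp ((inner ℝ x t : ℝ) * Complex.I) = (gaussConst (finrank ℝ V) : ℂ) *
        Complex.exp (-(1 / 2) * ‖x‖ ^ 2 + Complex.I * (inner ℝ t x : ℝ)) := by
    intro x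
    rw [ENNReal.toReal_ofReal (gaussDensity_nonneg x), gaussDensity, Complex.real_smul,
      real_inner_comm, Complex.exp_add]
    push_cast
    rw [mul_comm Complex.I, ← mul_assoc]
    congr 4
    ring
  simp_rw [this]
  rw [integral_const_mul, h, ← mul_assoc]
  have hc : (gaussConst (finrank ℝ V) : ℂ) * ((π : ℂ) / (1 / 2)) ^ ((finrank ℝ V : ℂ) / 2) = 1 := by
    rw [show (π : ℂ) / (1 / 2) = ((2 * π : ℝ) : ℂ) by push_cast; ring,
      show (finrank ℝ V : ℂ) / 2 = (((finrank ℝ V : ℝ) / 2 : ℝ) : ℂ) by push_cast; ring,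
      ← Complex.ofReal_cpow (by positivity), gaussConst, ← Complex.ofReal_mul,
      inv_mul_cancel₀ (by positivity), Complex.ofReal_one]
  rw [hc, one_mul, Complex.I_sq]
  congr 1
  ring

theorem integral_stdGaussian (f : V → ℝ) :
    ∫ x, f x ∂(stdGaussian V) = ∫ x, gaussDensity V x * f x := by
  rw [stdGaussian_eq_withDensity, integral_withDensity_eq_integral_toReal_smul
    measurable_gaussDensity.ennreal_ofReal (by simp)]
  simp [ENNReal.toReal_ofReal (gaussDensity_nonneg _)]

theorem lintegral_stdGaussian (f : V → ℝ≥0∞) :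
    ∫⁻ x, f x ∂(stdGaussian V) = ∫⁻ x, ENNReal.ofReal (gaussDensity V x) * f x := by
  rw [stdGaussian_eq_withDensity, lintegral_withDensity_eq_lintegral_mul_non_measurable _
    measurable_gaussDensity.ennreal_ofReal (by simp)]
  rfl

/-- Half of the squared norm of a standard Gaussian vector follows a Gamma distribution. -/
theorem map_half_norm_sq_stdGaussian (hV : 0 < finrank ℝ V) :
    (stdGaussian V).map (fun x => ‖x‖ ^ 2 / 2) = gammaMeasure ((finrank ℝ V : ℝ) / 2) 1 := by
  have : Nontrivial V := finrank_pos_iff.1 hV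
  set d := finrank ℝ V with hd
  have hd0 : (0 : ℝ) < d := by exact_mod_cast hV
  have ha : (0 : ℝ) < (d : ℝ) / 2 := by positivity
  have hmeas : Measurable fun x : V => ‖x‖ ^ 2 / 2 := by fun_prop
  have hP := isProbabilityMeasure_gammaMeasure ha one_pos
  have hQ : IsProbabilityMeasure ((stdGaussian V).map (fun x => ‖x‖ ^ 2 / 2)) :=
    Measure.isProbabilityMeasure_map hmeas.aemeasurable
  -- Polar coordinates give proportionality. The constant, which contains the volume of the unit
  -- ball, need not be evaluated: both sides are probability measures, so testing on `1` forces `C =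
  -- 1`.
  obtain ⟨C, hC⟩ : ∃ C : ℝ, ∀ f : ℝ → ℝ, Measurable f →
      ∫ x, f x ∂((stdGaussian V).map (fun x => ‖x‖ ^ 2 / 2)) =
        C * ∫ x, f x ∂(gammaMeasure ((d : ℝ) / 2) 1) := by
    refine ⟨gaussConst d * (d * (volume : Measure V).real (Metric.ball 0 1)) *
      (2 ^ ((d : ℝ) / 2 - 1) * Gamma ((d : ℝ) / 2)), fun f hf => ?_⟩
    rw [integral_map hmeas.aemeasurable hf.aestronglyMeasurable, integral_stdGaussian,
      integral_gammaMeasure ha one_pos]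
    have h1 := integral_fun_norm_addHaar (volume : Measure V)
      (fun y => gaussConst d * (exp (-y ^ 2 / 2) * f (y ^ 2 / 2)))
    simp_rw [gaussDensity, mul_assoc (gaussConst _)]
    rw [← hd] at h1 ⊢
    rw [h1]
    -- Two substitutions take the radius to the Gamma variable: `u = y²`, then `u = 2v`.
    have h2 := integral_comp_rpow_Ioi
      (fun u => u ^ ((d : ℝ) / 2 - 1) * exp (-u / 2) * f (u / 2)) (p := 2) two_ne_zero
    have h3 := integral_comp_mul_left_Ioi
      (fun u => u ^ ((d : ℝ) / 2 - 1) * exp (-u / 2) * f (u / 2)) 0 (b := 2) two_pos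
    rw [mul_zero, ← h2] at h3
    have h4 : ∀ y ∈ Ioi (0 : ℝ), (y ^ (d - 1)) • (gaussConst d * (exp (-y ^ 2 / 2) * f (y ^ 2 / 2)))
        = (gaussConst d / 2) * ((|2| * y ^ ((2 : ℝ) - 1)) •
          ((y ^ (2 : ℝ)) ^ ((d : ℝ) / 2 - 1) * exp (-(y ^ (2 : ℝ)) / 2) * f (y ^ (2 : ℝ) / 2))) := by
      intro y hy
      have hy' : (0 : ℝ) < y := hy
      have e1 : y ^ ((2 : ℝ) - 1) * (y ^ (2 : ℝ)) ^ ((d : ℝ) / 2 - 1) = y ^ (d - 1) := by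
        rw [← rpow_mul hy'.le, ← rpow_add hy', ← rpow_natCast]
        congr 1
        rw [Nat.cast_sub hV]
        push_cast
        ring
      rw [rpow_two] at e1 ⊢
      simp only [smul_eq_mul, abs_two]
      rw [← e1]
      ring
    have h5 : ∀ y ∈ Ioi (0 : ℝ), ((1 : ℝ) ^ ((d : ℝ) / 2) / Gamma ((d : ℝ) / 2) *
        y ^ ((d : ℝ) / 2 - 1) * exp (-(1 * y))) * f y =
        (2 ^ ((d : ℝ) / 2 - 1) * Gamma ((d : ℝ) / 2))⁻¹ *
          ((2 * y) ^ ((d : ℝ) / 2 - 1) * exp (-(2 * y) / 2) * f (2 * y / 2)) := by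
      intro y hy
      have hy' : (0 : ℝ) < y := hy
      have := Gamma_pos_of_pos ha
      rw [one_rpow, mul_rpow two_pos.le hy'.le, mul_div_cancel_left₀ _ (two_ne_zero' ℝ),
        one_mul, neg_div, mul_div_cancel_left₀ _ (two_ne_zero' ℝ)]
      field_simp
    rw [setIntegral_congr_fun measurableSet_Ioi h4, setIntegral_congr_fun measurableSet_Ioi h5,
      integral_const_mul, integral_const_mul, h3]
    have := Gamma_pos_of_pos ha
    simp only [smul_eq_mul, nsmul_eq_mul]
    field_simp
  have hC1 : C = 1 := by
    have := hC (fun _ => 1) measurable_const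
    simpa using this.symm
  ext s hs
  have := hC (s.indicator 1) (measurable_one.indicator hs)
  rw [hC1, one_mul, integral_indicator_one hs, integral_indicator_one hs] at this
  exact (measureReal_eq_measureReal_iff).1 this

/-- Orthogonal projections map standard Gaussian measures to standard Gaussian measures. -/
theorem map_orthogonalProjection_stdGaussian (K : Submodule ℝ V) :
    (stdGaussian V).map K.orthogonalProjectionOnto = stdGaussian K := by
  apply Measure.ext_of_charFun
  ext t
  rw [charFun_stdGaussian, charFun_apply, integral_map (by fun_prop) (by fun_prop)]
  simp_rw [Submodule.inner_orthogonalProjectionOnto_eq_of_mem_right]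
  rw [← charFun_apply, charFun_stdGaussian]
  simp

/-- The joint law of independent standard Gaussian vectors is the standard Gaussian measure of the
direct sum. -/
theorem map_pi_stdGaussian {ι : Type*} [Fintype ι] :
    (Measure.pi (fun _ : ι => stdGaussian V)).map (WithLp.toLp 2) =
      stdGaussian (PiLp 2 (fun _ : ι => V)) := by
  apply Measure.ext_of_charFun (E := PiLp 2 (fun _ : ι => V))
  ext t
  simp_rw [charFun_stdGaussian, charFun_pi, charFun_stdGaussian, ← Complex.exp_sum,
    ← Complex.ofReal_pow, PiLp.norm_sq_eq_of_L2]
  simp [Finset.sum_div, neg_div]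

theorem map_ofLp_stdGaussian {ι : Type*} [Fintype ι] :
    (stdGaussian (PiLp 2 (fun _ : ι => V))).map WithLp.ofLp =
      Measure.pi (fun _ : ι => stdGaussian V) := by
  rw [← map_pi_stdGaussian, Measure.map_map (by fun_prop) (by fun_prop)]
  exact Measure.map_id

end StdGaussian

end LogDet

namespace LogDet

open Set Real Module

/-! ### Gram determinants of Gaussian vectors. -/

section GramDeterminant

/-- Splitting off one vector from a Gram determinant. -/
theorem det_gram_cons {V : Type*} [NormedAddCommGroup V] [InnerProductSpace ℝ V] {p : ℕ} {a : V}
    (ha : a ≠ 0) (z : Fin p → V) :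
    (Matrix.gram ℝ (Fin.cons a z : Fin (p + 1) → V)).det =
      ‖a‖ ^ 2 * (Matrix.gram ℝ fun i => (ℝ ∙ a)ᗮ.orthogonalProjectionOnto (z i)).det := by
  have hna : ‖a‖ ^ 2 ≠ 0 := by positivity
  -- Row reduction with the projection coefficients onto `a`: row `0` is kept, column `0` is cleared
  -- below it, and the remaining block is the Gram matrix of the projections.
  let c : Fin (p + 1) → ℝ := Fin.cons 0 fun i => inner ℝ a (z i) / ‖a‖ ^ 2
  let A := Matrix.gram ℝ (Fin.cons a z : Fin (p + 1) → V)
  let B : Matrix (Fin (p + 1)) (Fin (p + 1)) ℝ := Matrix.of fun i j => A i j - c i * A 0 j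
  have hAB : A.det = B.det := by
    apply Matrix.det_eq_of_forall_row_eq_smul_add_const c 0 rfl
    intro i j
    simp [B, c]
  have hproj : ∀ i, ((ℝ ∙ a)ᗮ.orthogonalProjectionOnto (z i) : V) =
      z i - (inner ℝ a (z i) / ‖a‖ ^ 2) • a := by
    intro i
    have := Submodule.starProjection_singleton ℝ (v := a) (z i)
    rw [← Submodule.starProjection_apply, Submodule.starProjection_orthogonal_val, this]
    simp
  have h0 : B 0 0 = ‖a‖ ^ 2 := by simp [B, A, c]
  have hcol : ∀ i : Fin p, B i.succ 0 = 0 := by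
    intro i
    simp only [B, A, c, Matrix.of_apply, Matrix.gram_apply, Fin.cons_succ, Fin.cons_zero,
      real_inner_self_eq_norm_sq]
    rw [div_mul_cancel₀ _ hna, real_inner_comm, sub_self]
  have hsub : B.submatrix Fin.succ Fin.succ =
      Matrix.gram ℝ fun i => (ℝ ∙ a)ᗮ.orthogonalProjectionOnto (z i) := by
    ext i j
    simp only [B, A, c, Matrix.of_apply, Matrix.gram_apply, Fin.cons_succ, Fin.cons_zero,
      Matrix.submatrix_apply, Submodule.coe_inner, hproj, inner_sub_left, inner_sub_right,
      real_inner_smul_left, real_inner_smul_right, real_inner_self_eq_norm_sq]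
    rw [real_inner_comm (z i) a]
    field_simp
    ring
  change A.det = _
  rw [hAB, Matrix.det_succ_column_zero, Fin.sum_univ_succ]
  simp [hcol, h0, ← hsub]

theorem measurable_det_gram {V : Type*} [NormedAddCommGroup V] [InnerProductSpace ℝ V]
    [FiniteDimensional ℝ V] [MeasurableSpace V] [BorelSpace V] (p : ℕ) :
    Measurable fun z : Fin p → V => (Matrix.gram ℝ z).det := by
  apply Continuous.measurable
  apply Continuous.matrix_det
  refine continuous_matrix fun i j => ?_
  simp only [Matrix.gram_apply]
  fun_prop

/-- The Gram determinant of independent standard Gaussian vectors is distributed as a product of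
independent chi-squared variables with decreasing degrees of freedom. -/
theorem lintegral_det_gram (p : ℕ) {V : Type*} [NormedAddCommGroup V] [InnerProductSpace ℝ V]
    [FiniteDimensional ℝ V] [MeasurableSpace V] [BorelSpace V] (hp : p ≤ finrank ℝ V)
    (g : ℝ → ℝ≥0∞) (hg : Measurable g) :
    ∫⁻ z : Fin p → V, g (Matrix.gram ℝ z).det ∂(Measure.pi fun _ => stdGaussian V) =
      ∫⁻ s : Fin p → ℝ, g (∏ i, 2 * s i)
        ∂(Measure.pi fun i : Fin p => gammaMeasure (((finrank ℝ V - i : ℕ) : ℝ) / 2) 1) := by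
  induction p generalizing V g with
  | zero => simp
  | succ p ih =>
    have hV : 0 < finrank ℝ V := by omega
    have : Nontrivial V := finrank_pos_iff.1 hV
    have hprob : ∀ i : Fin (p + 1), IsProbabilityMeasure
        (gammaMeasure (((finrank ℝ V - i : ℕ) : ℝ) / 2) 1) := fun i =>
      isProbabilityMeasure_gammaMeasure
        (by have : 0 < finrank ℝ V - i := by omega
            positivity) one_pos
    have hpV := (measurePreserving_piFinSuccAbove
      (fun _ : Fin (p + 1) => stdGaussian V) 0).symm
    have hpR := (measurePreserving_piFinSuccAbove
      (fun i : Fin (p + 1) => gammaMeasure (((finrank ℝ V - i : ℕ) : ℝ) / 2) 1) 0).symm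
    have hmV : Measurable fun z : Fin (p + 1) → V => g (Matrix.gram ℝ z).det :=
      hg.comp (measurable_det_gram _)
    have hmR : Measurable fun s : Fin (p + 1) → ℝ => g (∏ i, 2 * s i) := by fun_prop
    rw [← hpV.lintegral_comp hmV, ← hpR.lintegral_comp hmR,
      lintegral_prod _ (by exact (hmV.comp (MeasurableEquiv.measurable _)).aemeasurable),
      lintegral_prod _ (by exact (hmR.comp (MeasurableEquiv.measurable _)).aemeasurable)]
    -- Needed so that the orthogonal complement of `a` loses exactly one dimension.
    have hne : ∀ᵐ a ∂(stdGaussian V), a ≠ 0 := by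
      rw [stdGaussian_eq_withDensity]
      refine (withDensity_absolutelyContinuous _ _).ae_le ?_
      exact compl_mem_ae_iff.2 (measure_singleton (0 : V))
    have hin : ∀ᵐ a ∂(stdGaussian V), ∫⁻ z : Fin p → V,
        g (Matrix.gram ℝ ((MeasurableEquiv.piFinSuccAbove (fun _ => V) 0).symm (a, z))).det
          ∂(Measure.pi fun _ => stdGaussian V) =
        ∫⁻ s : Fin p → ℝ, g ((2 * (‖a‖ ^ 2 / 2)) * ∏ i, 2 * s i)
          ∂(Measure.pi fun i : Fin p =>
            gammaMeasure (((finrank ℝ V - (i.succ : Fin (p + 1)) : ℕ) : ℝ) / 2) 1) := by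
      filter_upwards [hne] with a ha
      have hfr : finrank ℝ (ℝ ∙ a)ᗮ = finrank ℝ V - 1 := by
        have h1 := (ℝ ∙ a).finrank_add_finrank_orthogonal
        rw [finrank_span_singleton ha] at h1
        omega
      -- Given the first vector `a`, the projections of the others are independent standard
      -- Gaussians in the complement of `a`. The induction varies both `V` and `g`: the space
      -- becomes that complement, and the factor `‖a‖²` is absorbed into the test function.
      have := ih (V := (ℝ ∙ a)ᗮ) (by omega) (fun t => g ((2 * (‖a‖ ^ 2 / 2)) * t)) (by fun_prop)
      have hidx : ∀ i : Fin p, finrank ℝ (ℝ ∙ a)ᗮ - (i : ℕ) =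
          finrank ℝ V - ((i.succ : Fin (p + 1)) : ℕ) := by
        intro i; rw [hfr, Fin.val_succ]; omega
      simp_rw [hidx] at this
      rw [← this]
      simp_rw [← map_orthogonalProjection_stdGaussian (ℝ ∙ a)ᗮ]
      rw [← Measure.pi_map_pi (by fun_prop), lintegral_map]
      · refine lintegral_congr fun z => ?_
        have hcons : (MeasurableEquiv.piFinSuccAbove (fun _ : Fin (p + 1) => V) 0).symm (a, z) =
            Fin.cons a z := by
          simp only [MeasurableEquiv.piFinSuccAbove, Fin.insertNthEquiv_zero, Equiv.symm_symm,
            MeasurableEquiv.symm_mk, MeasurableEquiv.coe_mk]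
          rfl
        rw [hcons, det_gram_cons ha, mul_div_cancel₀ _ (two_ne_zero' ℝ)]
      · exact hg.comp ((measurable_det_gram p).const_mul _)
      · fun_prop
    rw [lintegral_congr_ae hin]
    have hm1 : Measurable fun x : ℝ => ∫⁻ s : Fin p → ℝ, g ((2 * x) * ∏ i, 2 * s i)
          ∂(Measure.pi fun i : Fin p =>
            gammaMeasure (((finrank ℝ V - (i.succ : Fin (p + 1)) : ℕ) : ℝ) / 2) 1) := by
      have : ∀ i : Fin p, IsProbabilityMeasure
        (gammaMeasure (((finrank ℝ V - (i.succ : Fin (p + 1)) : ℕ) : ℝ) / 2) 1) :=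
          fun i => hprob i.succ
      apply Measurable.lintegral_prod_right' (f := fun q : ℝ × (Fin p → ℝ) =>
        g ((2 * q.1) * ∏ i, 2 * q.2 i))
      fun_prop
    have hmap := map_half_norm_sq_stdGaussian hV
    rw [← lintegral_map (f := fun x : ℝ => ∫⁻ s : Fin p → ℝ, g ((2 * x) * ∏ i, 2 * s i)
          ∂(Measure.pi fun i : Fin p =>
            gammaMeasure (((finrank ℝ V - (i.succ : Fin (p + 1)) : ℕ) : ℝ) / 2) 1))
      (g := fun a : V => ‖a‖ ^ 2 / 2) hm1 (by fun_prop), hmap]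
    simp [MeasurableEquiv.piFinSuccAbove, Fin.prod_univ_succ]

end GramDeterminant

end LogDet

namespace LogDet

open Set Real Module
open scoped MatrixOrder

/-! ### Passing from observations to coordinate columns. -/

section Transpose

variable {ι κ : Type*} [Fintype ι] [Fintype κ]

/-- Transposition of a family of Euclidean vectors, as a linear isometry. -/
noncomputable def transposeIsometry (ι κ : Type*) [Fintype ι] [Fintype κ] :
    PiLp 2 (fun _ : ι => EuclideanSpace ℝ κ) ≃ₗᵢ[ℝ] PiLp 2 (fun _ : κ => EuclideanSpace ℝ ι) where
  toFun x := WithLp.toLp 2 fun j => WithLp.toLp 2 fun i => x i j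
  invFun x := WithLp.toLp 2 fun i => WithLp.toLp 2 fun j => x j i
  map_add' _ _ := rfl
  map_smul' _ _ := rfl
  left_inv _ := rfl
  right_inv _ := rfl
  norm_map' x := by
    have h : ∀ a b : ℝ, 0 ≤ a → 0 ≤ b → a ^ 2 = b ^ 2 → a = b := fun a b ha hb h =>
      (sq_eq_sq₀ ha hb).1 h
    refine h _ _ (norm_nonneg _) (norm_nonneg _) ?_
    rw [PiLp.norm_sq_eq_of_L2, PiLp.norm_sq_eq_of_L2]
    simp only [EuclideanSpace.real_norm_sq_eq]
    exact Finset.sum_comm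

/-- The observations are the rows of the data, while the Gram matrix is formed from its columns.
Transposition is an isometry, and a standard Gaussian measure is invariant under isometries. -/
theorem measurePreserving_transpose :
    MeasurePreserving (fun (x : ι → EuclideanSpace ℝ κ) (j : κ) =>
        (WithLp.toLp 2 fun i => x i j : EuclideanSpace ℝ ι))
      (Measure.pi fun _ => stdGaussian (EuclideanSpace ℝ κ))
      (Measure.pi fun _ => stdGaussian (EuclideanSpace ℝ ι)) := by
  have hfun : (fun (x : ι → EuclideanSpace ℝ κ) (j : κ) =>
      (WithLp.toLp 2 fun i => x i j : EuclideanSpace ℝ ι)) =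
      WithLp.ofLp ∘ (transposeIsometry ι κ) ∘ WithLp.toLp 2 := rfl
  refine ⟨by fun_prop, ?_⟩
  rw [hfun, ← Measure.map_map (by fun_prop) (by fun_prop),
    ← Measure.map_map (by fun_prop) (by fun_prop), map_pi_stdGaussian, stdGaussian_map,
    map_ofLp_stdGaussian]

end Transpose

/-! ### Law of the sample covariance determinant and risk of the estimator. -/

section SampleLaw

variable {n p : ℕ}

theorem sampleLaw_eq_map (μ : EuclideanSpace ℝ (Fin p)) (S : Matrix (Fin p) (Fin p) ℝ) :
    sampleLaw n p μ S = (Measure.pi fun _ : Fin (n + 1) =>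
      stdGaussian (EuclideanSpace ℝ (Fin p))).map
        (fun z k => μ + Matrix.toEuclideanCLM (𝕜 := ℝ) (CFC.sqrt S) (z k)) := by
  unfold sampleLaw multivariateGaussian
  refine (Measure.pi_map_pi (f := fun _ z =>
    μ + Matrix.toEuclideanCLM (𝕜 := ℝ) (CFC.sqrt S) z) fun _ => ?_).symm
  fun_prop

theorem sampleMean_affine (μ : EuclideanSpace ℝ (Fin p)) (A : Matrix (Fin p) (Fin p) ℝ)
    (z : Sample n p) :
    sampleMean (fun k => μ + Matrix.toEuclideanCLM (𝕜 := ℝ) A (z k)) =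
      μ + Matrix.toEuclideanCLM (𝕜 := ℝ) A (sampleMean z) := by
  unfold sampleMean
  have h : ((n : ℝ) + 1) ≠ 0 := by positivity
  rw [Finset.sum_add_distrib, smul_add, map_smul, map_sum]
  simp only [Finset.sum_const, Finset.card_univ, Fintype.card_fin]
  rw [← Nat.cast_smul_eq_nsmul ℝ, smul_smul]
  push_cast
  rw [inv_mul_cancel₀ h, one_smul]

theorem sampleCov_affine (μ : EuclideanSpace ℝ (Fin p)) (A : Matrix (Fin p) (Fin p) ℝ)
    (z : Sample n p) :
    sampleCov (fun k => μ + Matrix.toEuclideanCLM (𝕜 := ℝ) A (z k)) =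
      A * sampleCov z * A.transpose := by
  have hvec : ∀ x : Sample n p, sampleCov x =
      (n : ℝ)⁻¹ • ∑ k, Matrix.vecMulVec (x k - sampleMean x).ofLp (x k - sampleMean x).ofLp :=
    fun x => rfl
  rw [hvec, hvec, sampleMean_affine, Matrix.mul_smul, Matrix.smul_mul, Finset.mul_sum,
    Finset.sum_mul]
  congr 1
  refine Finset.sum_congr rfl fun k _ => ?_
  rw [Matrix.mul_vecMulVec, Matrix.vecMulVec_mul, Matrix.vecMul_transpose]
  have : (μ + Matrix.toEuclideanCLM (𝕜 := ℝ) A (z k) -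
      (μ + Matrix.toEuclideanCLM (𝕜 := ℝ) A (sampleMean z))).ofLp =
      A.mulVec (z k - sampleMean z).ofLp := by
    rw [add_sub_add_left_eq_sub, ← map_sub, Matrix.ofLp_toEuclideanCLM]
  rw [this]

theorem det_sqrt_mul_self {S : Matrix (Fin p) (Fin p) ℝ} (hS : S.PosDef) :
    (CFC.sqrt S).det * (CFC.sqrt S).det = S.det := by
  rw [← Matrix.det_mul]
  congr 1
  exact CFC.sqrt_mul_sqrt_self _ hS.posSemidef.nonneg

/-- Centring removes `μ`, and the two factors `CFC.sqrt S` contribute `S.det`. On the log scale `S`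
is a pure shift, which the risk cancels. -/
theorem det_sampleCov_affine (μ : EuclideanSpace ℝ (Fin p)) {S : Matrix (Fin p) (Fin p) ℝ}
    (hS : S.PosDef) (z : Sample n p) :
    (sampleCov (fun k => μ + Matrix.toEuclideanCLM (𝕜 := ℝ) (CFC.sqrt S) (z k))).det =
      S.det * (sampleCov z).det := by
  rw [sampleCov_affine, Matrix.det_mul, Matrix.det_mul, Matrix.det_transpose,
    ← det_sqrt_mul_self hS]
  ring

/-- The vector of ones. -/
noncomputable def onesVec (n : ℕ) : EuclideanSpace ℝ (Fin (n + 1)) := WithLp.toLp 2 fun _ => 1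

theorem norm_sq_onesVec : ‖onesVec n‖ ^ 2 = n + 1 := by
  simp [EuclideanSpace.real_norm_sq_eq, onesVec]

theorem onesVec_ne_zero : onesVec n ≠ 0 := by
  intro h
  have := norm_sq_onesVec (n := n)
  rw [h] at this
  simp at this
  have h0 : (0 : ℝ) ≤ n := n.cast_nonneg
  linarith

/-- Centring projects off the vector of ones: the unknown mean costs one of the `n + 1` dimensions.
-/
theorem finrank_onesVec_orthogonal : finrank ℝ (ℝ ∙ onesVec n)ᗮ = n := by
  have h1 := (ℝ ∙ onesVec n).finrank_add_finrank_orthogonal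
  rw [finrank_span_singleton onesVec_ne_zero, finrank_euclideanSpace_fin] at h1
  omega

/-- The sample covariance matrix is the Gram matrix of the centred columns. -/
theorem sampleCov_eq_gram (z : Sample n p) :
    sampleCov z = (n : ℝ)⁻¹ • Matrix.gram ℝ fun j : Fin p =>
      (ℝ ∙ onesVec n)ᗮ.orthogonalProjectionOnto (WithLp.toLp 2 fun k => z k j) := by
  have hproj : ∀ (j : Fin p) (k : Fin (n + 1)),
      (((ℝ ∙ onesVec n)ᗮ.orthogonalProjectionOnto (WithLp.toLp 2 fun k => z k j) :
        (ℝ ∙ onesVec n)ᗮ) : EuclideanSpace ℝ (Fin (n + 1))) k = z k j - sampleMean z j := by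
    intro j k
    have := Submodule.starProjection_singleton ℝ (v := onesVec n) (WithLp.toLp 2 fun k => z k j)
    rw [← Submodule.starProjection_apply, Submodule.starProjection_orthogonal_val, this]
    have h2 := norm_sq_onesVec (n := n)
    have h3 : sampleMean z j = (∑ k, z k j) / (n + 1) := by
      simp [sampleMean, div_eq_inv_mul]
    simp only [RCLike.ofReal_real_eq_id, id_eq, h2, h3]
    simp [onesVec, PiLp.inner_apply]
  unfold sampleCov
  congr 1
  ext i j
  rw [Matrix.sum_apply, Matrix.gram_apply, Submodule.coe_inner, PiLp.inner_apply]
  refine Finset.sum_congr rfl fun k _ => ?_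
  simp only [hproj, Matrix.of_apply]
  simp [mul_comm]

theorem measurable_estimator : Measurable (estimator n p) := by
  have h : Continuous fun x : Sample n p => (sampleCov x).det := by
    apply Continuous.matrix_det
    refine continuous_matrix fun i j => ?_
    simp only [sampleCov, sampleMean, Matrix.smul_apply, Matrix.sum_apply, Matrix.of_apply]
    fun_prop
  unfold estimator
  exact (measurable_log.comp h.measurable).sub_const _

theorem lintegral_det_sampleCov (hpn : p ≤ n) (g : ℝ → ℝ≥0∞) (hg : Measurable g) :
    ∫⁻ z : Sample n p, g (sampleCov z).det
        ∂(Measure.pi fun _ => stdGaussian (EuclideanSpace ℝ (Fin p))) =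
      ∫⁻ s : Fin p → ℝ, g ((n : ℝ)⁻¹ ^ p * ∏ i, 2 * s i)
        ∂(Measure.pi fun i : Fin p => gammaMeasure (((n - i : ℕ) : ℝ) / 2) 1) := by
  have hg' : Measurable fun t => g ((n : ℝ)⁻¹ ^ p * t) := by fun_prop
  have hm : Measurable fun w : Fin p → EuclideanSpace ℝ (Fin (n + 1)) =>
      g ((n : ℝ)⁻¹ ^ p * (Matrix.gram ℝ fun j =>
        (ℝ ∙ onesVec n)ᗮ.orthogonalProjectionOnto (w j)).det) := by
    refine hg'.comp ((measurable_det_gram p).comp ?_)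
    fun_prop
  have h1 := lintegral_det_gram p (V := (ℝ ∙ onesVec n)ᗮ)
    (by rw [finrank_onesVec_orthogonal]; exact hpn) _ hg'
  rw [finrank_onesVec_orthogonal] at h1
  rw [← h1]
  simp_rw [sampleCov_eq_gram, Matrix.det_smul, Fintype.card_fin]
  rw [measurePreserving_transpose.lintegral_comp hm]
  simp_rw [← map_orthogonalProjection_stdGaussian (ℝ ∙ onesVec n)ᗮ]
  rw [← Measure.pi_map_pi (by fun_prop), lintegral_map]
  · exact hg'.comp (measurable_det_gram p)
  · fun_prop

theorem tau_eq (n p : ℕ) (hpn : p ≤ n) :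
    tau n p = ∑ i : Fin p, (digamma (((n - i : ℕ) : ℝ) / 2) - log ((n : ℝ) / 2)) := by
  unfold tau
  rw [← Finset.Ico_add_one_right_eq_Icc, Finset.sum_Ico_eq_sum_range, Nat.add_sub_cancel,
    Finset.sum_range]
  refine Finset.sum_congr rfl fun i _ => ?_
  rw [Nat.cast_sub (by omega)]
  push_cast
  congr 3
  ring

/-- The risk of the bias-corrected log-determinant does not depend on the parameters and is a
sum of variances of logarithms of Gamma variables. -/
theorem risk_estimator_le (hpn : p + 2 ≤ n) (μ : EuclideanSpace ℝ (Fin p))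
    {S : Matrix (Fin p) (Fin p) ℝ} (hS : S.PosDef) :
    risk (estimator n p) μ S ≤
      ENNReal.ofReal (∑ i ∈ Finset.range p, 2 / ((n : ℝ) - i - 2)) := by
  -- The gap `p + 2 ≤ n` leaves at least three degrees of freedom, so every shape is at least `3/2`
  -- and inverse moments exist.
  have hidx : ∀ i : Fin p, (1 : ℝ) < ((n - i : ℕ) : ℝ) / 2 := by
    intro i
    have : (3 : ℝ) ≤ ((n - i : ℕ) : ℝ) := by
      have : 3 ≤ n - (i : ℕ) := by omega
      exact_mod_cast this
    linarith
  have hn : (0 : ℝ) < n := by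
    have : 0 < n := by omega
    exact_mod_cast this
  have hprob : ∀ i : Fin p, IsProbabilityMeasure (gammaMeasure (((n - i : ℕ) : ℝ) / 2) 1) :=
    fun i => isProbabilityMeasure_gammaMeasure (by linarith [hidx i]) one_pos
  set P := Measure.pi fun i : Fin p => gammaMeasure (((n - i : ℕ) : ℝ) / 2) 1 with hP
  have hdet := hS.det_pos
  have hlog : ∀ i : Fin p, MemLp log 2 (gammaMeasure (((n - i : ℕ) : ℝ) / 2) 1) :=
    fun i => memLp_log_gammaMeasure (hidx i)
  have hlogP : ∀ i : Fin p, MemLp (fun s : Fin p → ℝ => log (s i)) 2 P := fun i =>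
    (hlog i).comp_measurePreserving (measurePreserving_eval _ i)
  have hsum : MemLp (∑ i : Fin p, fun s : Fin p → ℝ => log (s i)) 2 P :=
    memLp_finsetSum' _ fun i _ => hlogP i
  have hmean : ∫ s, (∑ i : Fin p, fun s : Fin p → ℝ => log (s i)) s ∂P =
      ∑ i : Fin p, digamma (((n - i : ℕ) : ℝ) / 2) := by
    simp_rw [Finset.sum_apply]
    rw [integral_finsetSum _ fun i _ => (hlogP i).integrable (by norm_num)]
    refine Finset.sum_congr rfl fun i _ => ?_
    rw [← integral_log_gammaMeasure (by linarith [hidx i]),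
      ← (measurePreserving_eval (fun i : Fin p =>
        gammaMeasure (((n - i : ℕ) : ℝ) / 2) 1) i).map_eq,
      integral_map (measurable_pi_apply i).aemeasurable (by fun_prop)]
  have hpos : ∀ᵐ s ∂P, ∀ i, 0 < s i := by
    rw [ae_all_iff]
    intro i
    exact (measurePreserving_eval (fun i : Fin p =>
        gammaMeasure (((n - i : ℕ) : ℝ) / 2) 1) i).quasiMeasurePreserving.ae
          (ae_pos_gammaMeasure _ _)
  have hmeasA : Measurable fun (z : Sample n p) k =>
      μ + Matrix.toEuclideanCLM (𝕜 := ℝ) (CFC.sqrt S) (z k) := by fun_prop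
  calc risk (estimator n p) μ S
      = ∫⁻ z : Sample n p, ENNReal.ofReal
          ((log (S.det * (sampleCov z).det) - tau n p - log S.det) ^ 2)
            ∂(Measure.pi fun _ => stdGaussian (EuclideanSpace ℝ (Fin p))) := by
        unfold risk
        rw [sampleLaw_eq_map, lintegral_map _ hmeasA]
        · simp_rw [estimator, det_sampleCov_affine μ hS]
        · exact ((measurable_estimator.sub_const _).pow_const 2).ennreal_ofReal
    _ = ∫⁻ s : Fin p → ℝ, ENNReal.ofReal
          ((log (S.det * ((n : ℝ)⁻¹ ^ p * ∏ i, 2 * s i)) - tau n p - log S.det) ^ 2) ∂P :=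
        lintegral_det_sampleCov (by omega)
          (fun t => ENNReal.ofReal ((log (S.det * t) - tau n p - log S.det) ^ 2)) (by fun_prop)
    _ = ∫⁻ s : Fin p → ℝ, ENNReal.ofReal (((∑ i : Fin p, fun s : Fin p → ℝ => log (s i)) s -
          ∫ s, (∑ i : Fin p, fun s : Fin p → ℝ => log (s i)) s ∂P) ^ 2) ∂P := by
        apply lintegral_congr_ae
        filter_upwards [hpos] with s hs
        -- The normalisation `1/n` and the chi-squared factor `2` combine into the `log (n/2)` terms
        -- of `tau`; what remains is the centred sum of logarithms.
        have hprod : (n : ℝ)⁻¹ ^ p * ∏ i, 2 * s i = ∏ i, (s i / (n / 2)) := by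
          have hconst : (n : ℝ)⁻¹ ^ p = ∏ _i : Fin p, (n : ℝ)⁻¹ := by simp
          rw [hconst, ← Finset.prod_mul_distrib]
          refine Finset.prod_congr rfl fun i _ => ?_
          field_simp
        have hpi : ∀ i, s i / ((n : ℝ) / 2) ≠ 0 := fun i => by have := hs i; positivity
        rw [hmean, hprod, log_mul hdet.ne' (Finset.prod_ne_zero_iff.2 fun i _ => hpi i),
          log_prod fun i _ => hpi i, tau_eq n p (by omega), Finset.sum_apply]
        have : ∀ i : Fin p, log (s i / (n / 2)) = log (s i) - log ((n : ℝ) / 2) := fun i =>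
          log_div (hs i).ne' (by positivity)
        simp_rw [this, Finset.sum_sub_distrib]
        congr 2
        ring
    _ = ENNReal.ofReal (∑ i : Fin p, Var[log; gammaMeasure (((n - i : ℕ) : ℝ) / 2) 1]) := by
        rw [← variance_sum_pi hlog, variance_eq_integral hsum.aemeasurable,
          ← ofReal_integral_eq_lintegral_ofReal]
        · exact (hsum.sub (memLp_const _)).integrable_sq
        · exact ae_of_all _ fun _ => sq_nonneg _
    _ ≤ _ := by
        rw [Finset.sum_range]
        refine ENNReal.ofReal_le_ofReal (Finset.sum_le_sum fun i _ => ?_)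
        refine (variance_log_gammaMeasure_le (hidx i)).trans_eq ?_
        have := hidx i
        rw [Nat.cast_sub (by omega)] at this ⊢
        have h2 : (n : ℝ) - i - 2 ≠ 0 := by linarith
        have h3 : ((n : ℝ) - i) / 2 - 1 ≠ 0 := by linarith
        field_simp

end SampleLaw

end LogDet

namespace LogDet

open Set Real Module
open scoped MatrixOrder

/-! ### Bayes risk under an exponential prior on the precision. -/

section BayesRisk

variable {V : Type*} [NormedAddCommGroup V] [InnerProductSpace ℝ V] [FiniteDimensional ℝ V]
  [MeasurableSpace V] [BorelSpace V]

theorem lintegral_comp_smul {r : ℝ} (hr : 0 < r) {f : V → ℝ≥0∞} (hf : Measurable f) :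
    ∫⁻ x, f (r • x) = ENNReal.ofReal ((r ^ finrank ℝ V)⁻¹) * ∫⁻ x, f x := by
  rw [← lintegral_map hf (by fun_prop), Measure.map_addHaar_smul _ hr.ne', lintegral_smul_measure,
    abs_of_pos (by positivity), smul_eq_mul]

theorem lintegral_gammaMeasure_rate {a r : ℝ} (hr : 0 < r) {f : ℝ → ℝ≥0∞}
    (hf : Measurable f) :
    ∫⁻ x, f x ∂(gammaMeasure a r) = ∫⁻ x, f (r⁻¹ * x) ∂(gammaMeasure a 1) := by
  rw [lintegral_gammaMeasure, lintegral_gammaMeasure, ← lintegral_indicator measurableSet_Ioi,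
    ← lintegral_indicator measurableSet_Ioi]
  have h := lintegral_comp_smul (inv_pos.2 hr) (f := (Ioi (0 : ℝ)).indicator fun x =>
    ENNReal.ofReal (r ^ a / Gamma a * x ^ (a - 1) * exp (-(r * x))) * f x)
    (Measurable.indicator (by fun_prop) measurableSet_Ioi)
  simp only [finrank_self, pow_one, inv_inv, smul_eq_mul] at h
  have h2 : ENNReal.ofReal r⁻¹ * ENNReal.ofReal r = 1 := by
    rw [← ENNReal.ofReal_mul (by positivity), inv_mul_cancel₀ hr.ne', ENNReal.ofReal_one]
  rw [← one_mul (lintegral _ _), ← h2, mul_assoc, ← h, ← lintegral_const_mul']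
  · refine lintegral_congr fun x => ?_
    by_cases hx : 0 < x
    · have hx' : 0 < r⁻¹ * x := by positivity
      rw [indicator_of_mem (mem_Ioi.2 hx), indicator_of_mem (mem_Ioi.2 hx'), ← mul_assoc,
        ← ENNReal.ofReal_mul (by positivity)]
      congr 2
      rw [mul_rpow (by positivity) hx.le, rpow_sub_one (inv_pos.2 hr).ne', inv_rpow hr.le,
        mul_inv_cancel_left₀ hr.ne', one_rpow, one_mul]
      have := rpow_pos_of_pos hr a
      field_simp
    · have hx' : ¬ 0 < r⁻¹ * x := by
        rw [mul_pos_iff_of_pos_left (inv_pos.2 hr)]; exact hx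
      rw [indicator_of_notMem (mt mem_Ioi.1 hx), indicator_of_notMem (mt mem_Ioi.1 hx'),
        mul_zero]
  · simp

/-- The rate only shifts the logarithm, and `one_div_le_integral_sq_log_gammaMeasure` allows any
shift. Here `b` stands for the value of an arbitrary estimator at the observed data. -/
theorem le_lintegral_sq_log_gammaMeasure {a r : ℝ} (ha : 1 < a) (hr : 0 < r) (b c : ℝ) :
    ENNReal.ofReal (c ^ 2 / a) ≤
      ∫⁻ x, ENNReal.ofReal ((b + c * log x) ^ 2) ∂(gammaMeasure a r) := by
  rcases eq_or_ne c 0 with rfl | hc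
  · simp
  have := isProbabilityMeasure_gammaMeasure (a := a) (by linarith) one_pos
  rw [lintegral_gammaMeasure_rate hr (by fun_prop)]
  have hL : MemLp (fun x => log x + (b / c - log r)) 2 (gammaMeasure a 1) :=
    (memLp_log_gammaMeasure ha).add (memLp_const _)
  calc ENNReal.ofReal (c ^ 2 / a)
      ≤ ENNReal.ofReal (∫ x, c ^ 2 * (log x + (b / c - log r)) ^ 2 ∂(gammaMeasure a 1)) := by
        refine ENNReal.ofReal_le_ofReal ?_
        rw [integral_const_mul, div_eq_mul_one_div]
        gcongr
        exact one_div_le_integral_sq_log_gammaMeasure ha _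
    _ = ∫⁻ x, ENNReal.ofReal (c ^ 2 * (log x + (b / c - log r)) ^ 2) ∂(gammaMeasure a 1) :=
        ofReal_integral_eq_lintegral_ofReal (hL.integrable_sq.const_mul _)
          (ae_of_all _ fun x => by positivity)
    _ = _ := by
        apply lintegral_congr_ae
        filter_upwards [ae_pos_gammaMeasure a 1] with x hx
        rw [log_mul (inv_pos.2 hr).ne' hx.ne', log_inv, ← mul_pow]
        congr 2
        field_simp
        ring

theorem lintegral_stdGaussian_comp_smul {s : ℝ} (hs : 0 < s) {f : V → ℝ≥0∞}
    (hf : Measurable f) :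
    ∫⁻ y, f ((√s)⁻¹ • y) ∂(stdGaussian V) =
      ∫⁻ x, ENNReal.ofReal (gaussConst (finrank ℝ V) * s ^ ((finrank ℝ V : ℝ) / 2) *
        exp (-(s * (‖x‖ ^ 2 / 2)))) * f x := by
  have hs' : 0 < √s := sqrt_pos.2 hs
  rw [lintegral_stdGaussian]
  have h := lintegral_comp_smul (V := V) (inv_pos.2 hs') (f := fun x =>
    ENNReal.ofReal (gaussDensity V (√s • x)) * f x)
    ((measurable_gaussDensity.comp (by fun_prop)).ennreal_ofReal.mul hf)
  simp only [smul_inv_smul₀ hs'.ne'] at h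
  rw [h, ← lintegral_const_mul']
  · refine lintegral_congr fun x => ?_
    rw [← mul_assoc, ← ENNReal.ofReal_mul (by positivity)]
    congr 2
    have h1 : (√s) ^ finrank ℝ V = s ^ ((finrank ℝ V : ℝ) / 2) := by
      rw [sqrt_eq_rpow, ← rpow_natCast, ← rpow_mul hs.le]
      congr 1
      ring
    rw [gaussDensity, norm_smul, mul_pow, norm_of_nonneg hs'.le, sq_sqrt hs.le, inv_pow, inv_inv,
      h1]
    rw [show -(s * ‖x‖ ^ 2) / 2 = -(s * (‖x‖ ^ 2 / 2)) by ring]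
    ring
  · simp

/-- Bayes' formula for a standard exponential prior on the precision of a Gaussian vector: the
posterior is a Gamma distribution. -/
theorem lintegral_bayes {F : V → ℝ → ℝ≥0∞} (hF : Measurable (Function.uncurry F)) :
    ∫⁻ s, ∫⁻ y, F ((√s)⁻¹ • y) s ∂(stdGaussian V) ∂(gammaMeasure 1 1) =
      ∫⁻ x : V, ENNReal.ofReal (gaussConst (finrank ℝ V) * Gamma ((finrank ℝ V : ℝ) / 2 + 1) /
        (1 + ‖x‖ ^ 2 / 2) ^ ((finrank ℝ V : ℝ) / 2 + 1)) *
          ∫⁻ s, F x s ∂(gammaMeasure ((finrank ℝ V : ℝ) / 2 + 1) (1 + ‖x‖ ^ 2 / 2)) := by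
  set a := (finrank ℝ V : ℝ) / 2 + 1 with ha
  have ha0 : 0 < a := by positivity
  have hG := Gamma_pos_of_pos ha0
  have hκ := gaussConst_pos (finrank ℝ V)
  rw [lintegral_gammaMeasure]
  calc _ = ∫⁻ s in Ioi 0, ∫⁻ x : V, ENNReal.ofReal (gaussConst (finrank ℝ V) *
        s ^ ((finrank ℝ V : ℝ) / 2) * exp (-((1 + ‖x‖ ^ 2 / 2) * s))) * F x s := by
        refine setLIntegral_congr_fun measurableSet_Ioi fun s hs => ?_
        rw [lintegral_stdGaussian_comp_smul hs (f := fun x => F x s)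
          (hF.comp (by fun_prop : Measurable fun x : V => (x, s))), ← lintegral_const_mul' _ _ (by simp)]
        refine lintegral_congr fun x => ?_
        have hs' : 0 < s := hs
        rw [← mul_assoc, ← ENNReal.ofReal_mul (by simp; positivity)]
        congr 2
        rw [show -((1 + ‖x‖ ^ 2 / 2) * s) = -(1 * s) + -(s * (‖x‖ ^ 2 / 2)) by ring, exp_add]
        simp
        ring
    _ = ∫⁻ x : V, ∫⁻ s in Ioi 0, ENNReal.ofReal (gaussConst (finrank ℝ V) *
        s ^ ((finrank ℝ V : ℝ) / 2) * exp (-((1 + ‖x‖ ^ 2 / 2) * s))) * F x s := by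
        rw [lintegral_lintegral_swap]
        refine Measurable.aemeasurable ?_
        refine Measurable.mul (by fun_prop) ?_
        exact hF.comp measurable_swap
    _ = _ := by
        refine lintegral_congr fun x => ?_
        have hβ : 0 < 1 + ‖x‖ ^ 2 / 2 := by positivity
        rw [lintegral_gammaMeasure, ← lintegral_const_mul' _ _ (by simp)]
        refine setLIntegral_congr_fun measurableSet_Ioi fun s hs => ?_
        have hs' : 0 < s := hs
        rw [← mul_assoc, ← ENNReal.ofReal_mul (by positivity), ha, add_sub_cancel_right]
        congr 2
        have := rpow_pos_of_pos hβ a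
        rw [ha] at this hG
        field_simp

/-- The posterior shape does not depend on the observation, so the same bound holds for every
posterior risk and survives averaging over the marginal. -/
theorem le_bayes_risk (hV : 0 < finrank ℝ V) {δ : V → ℝ} (hδ : Measurable δ) (c : ℝ) :
    ENNReal.ofReal (c ^ 2 / ((finrank ℝ V : ℝ) / 2 + 1)) ≤
      ∫⁻ s, ∫⁻ y, ENNReal.ofReal ((δ ((√s)⁻¹ • y) + c * log s) ^ 2) ∂(stdGaussian V)
        ∂(gammaMeasure 1 1) := by
  have hV' : (0 : ℝ) < finrank ℝ V := by exact_mod_cast hV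
  have := isProbabilityMeasure_gammaMeasure one_pos one_pos
  -- Taking `F = 1` shows that the weight in Bayes' formula, the marginal density of the
  -- observation, has total mass one.
  have h1 := lintegral_bayes (V := V) (F := fun _ _ => 1) measurable_const
  have hprob : ∀ x : V, IsProbabilityMeasure
      (gammaMeasure ((finrank ℝ V : ℝ) / 2 + 1) (1 + ‖x‖ ^ 2 / 2)) := fun x =>
    isProbabilityMeasure_gammaMeasure (by positivity) (by positivity)
  simp only [lintegral_one, measure_univ, mul_one] at h1
  rw [lintegral_bayes (F := fun x s => ENNReal.ofReal ((δ x + c * log s) ^ 2))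
    (by unfold Function.uncurry; fun_prop)]
  calc ENNReal.ofReal (c ^ 2 / ((finrank ℝ V : ℝ) / 2 + 1))
      = 1 * ENNReal.ofReal (c ^ 2 / ((finrank ℝ V : ℝ) / 2 + 1)) := (one_mul _).symm
    _ ≤ _ := by
      rw [h1, ← lintegral_mul_const' _ _ (by simp)]
      refine lintegral_mono fun x => ?_
      simp only
      gcongr
      exact le_lintegral_sq_log_gammaMeasure (by linarith) (by positivity) _ _

end BayesRisk

/-! ### Bounds for the minimax risk. -/

section Minimax

variable {n p : ℕ}

theorem sqrt_smul_one {s : ℝ} (hs : 0 < s) :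
    CFC.sqrt (s⁻¹ • (1 : Matrix (Fin p) (Fin p) ℝ)) = (√s)⁻¹ • 1 := by
  apply CFC.sqrt_unique
  · rw [smul_mul_smul_comm, one_mul, ← mul_inv, mul_self_sqrt hs.le]
  · rw [Matrix.nonneg_iff_posSemidef]
    exact Matrix.PosSemidef.one.smul (by positivity)

theorem risk_scalar {δ : Sample n p → ℝ} (hδ : Measurable δ) (μ : EuclideanSpace ℝ (Fin p))
    {s : ℝ} (hs : 0 < s) :
    risk δ μ (s⁻¹ • 1) = ∫⁻ y : PiLp 2 (fun _ : Fin (n + 1) => EuclideanSpace ℝ (Fin p)),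
      ENNReal.ofReal ((δ (fun k => μ + ((√s)⁻¹ • y) k) + p * log s) ^ 2) ∂(stdGaussian _) := by
  have hm : Measurable fun x : Sample n p =>
      ENNReal.ofReal ((δ x - log (s⁻¹ • (1 : Matrix (Fin p) (Fin p) ℝ)).det) ^ 2) :=
    ((hδ.sub_const _).pow_const 2).ennreal_ofReal
  unfold risk
  have hm' : Measurable fun z : Sample n p => ENNReal.ofReal
      ((δ (fun k => μ + Matrix.toEuclideanCLM (𝕜 := ℝ) (CFC.sqrt (s⁻¹ • 1)) (z k)) -
        log (s⁻¹ • (1 : Matrix (Fin p) (Fin p) ℝ)).det) ^ 2) :=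
    hm.comp (by fun_prop : Measurable fun (z : Sample n p) k =>
      μ + Matrix.toEuclideanCLM (𝕜 := ℝ) (CFC.sqrt (s⁻¹ • 1)) (z k))
  rw [sampleLaw_eq_map, lintegral_map hm (by fun_prop), ← map_ofLp_stdGaussian,
    lintegral_map hm' (by fun_prop)]
  refine lintegral_congr fun y => ?_
  simp [sqrt_smul_one hs]

/-- The maximal risk dominates any prior average. One mean in `M` and scalar covariances suffice;
the sample is then a single Gaussian vector of dimension `(n+1)p`. -/
theorem le_maxRisk (hp : 0 < p) {M : Set (EuclideanSpace ℝ (Fin p))} (hM : M.Nonempty)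
    {δ : Sample n p → ℝ} (hδ : Measurable δ) :
    ENNReal.ofReal ((p : ℝ) ^ 2 / (((n : ℝ) + 1) * p / 2 + 1)) ≤ maxRisk M δ := by
  obtain ⟨μ, hμ⟩ := hM
  have hrank : finrank ℝ (PiLp 2 (fun _ : Fin (n + 1) => EuclideanSpace ℝ (Fin p))) =
      (n + 1) * p := by
    rw [(WithLp.linearEquiv 2 ℝ (Fin (n + 1) → EuclideanSpace ℝ (Fin p))).finrank_eq,
      finrank_pi_fintype]
    simp
  have h := le_bayes_risk (V := PiLp 2 (fun _ : Fin (n + 1) => EuclideanSpace ℝ (Fin p)))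
    (by rw [hrank]; positivity) (δ := fun y => δ fun k => μ + y k) (hδ.comp (by fun_prop)) p
  rw [hrank] at h
  push_cast at h
  have := isProbabilityMeasure_gammaMeasure one_pos one_pos
  calc _ ≤ _ := h
    _ ≤ ∫⁻ _s, maxRisk M δ ∂(gammaMeasure 1 1) := by
      apply lintegral_mono_ae
      filter_upwards [ae_pos_gammaMeasure 1 1] with s hs
      rw [← risk_scalar hδ μ hs]
      exact le_iSup₂_of_le μ hμ
        (le_iSup₂_of_le (s⁻¹ • 1) (Matrix.PosDef.one.smul (inv_pos.2 hs)) le_rfl)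
    _ = maxRisk M δ := by simp

theorem le_minimaxRisk (hp : 0 < p) {M : Set (EuclideanSpace ℝ (Fin p))} (hM : M.Nonempty) :
    ENNReal.ofReal ((p : ℝ) ^ 2 / (((n : ℝ) + 1) * p / 2 + 1)) ≤ minimaxRisk n p M :=
  le_iInf₂ fun _ hδ => le_maxRisk hp hM hδ

theorem maxRisk_estimator_le (hpn : p + 2 ≤ n) (M : Set (EuclideanSpace ℝ (Fin p))) :
    maxRisk M (estimator n p) ≤ ENNReal.ofReal (∑ i ∈ Finset.range p, 2 / ((n : ℝ) - i - 2)) :=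
  iSup₂_le fun μ _ => iSup₂_le fun _ hS => risk_estimator_le hpn μ hS

theorem minimaxRisk_le_maxRisk_estimator (M : Set (EuclideanSpace ℝ (Fin p))) :
    minimaxRisk n p M ≤ maxRisk M (estimator n p) :=
  iInf₂_le _ measurable_estimator

end Minimax

end LogDet

namespace LogDet

/-! ### Elementary estimates and limits. -/

section Asymptotics

variable {n p : ℕ}

theorem le_scalar_bound (hp : 0 < p) :
    2 * (p : ℝ) / (n + 3) ≤ (p : ℝ) ^ 2 / (((n : ℝ) + 1) * p / 2 + 1) := by
  have hp' : (1 : ℝ) ≤ p := by exact_mod_cast hp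
  have hn : (0 : ℝ) ≤ n := n.cast_nonneg
  rw [div_le_div_iff₀ (by positivity) (by positivity)]
  nlinarith [mul_nonneg (by linarith : (0 : ℝ) ≤ p) (by linarith : (0 : ℝ) ≤ (p : ℝ) - 1)]

/-- Every term is at most the last. This form is proportional to `p`, as needed after multiplication
by `n/p`; the remainder in `variance_bound_le_log` need not vanish under that scaling when `p` is
bounded. -/
theorem variance_bound_le (hpn : p + 3 ≤ n) :
    ∑ i ∈ Finset.range p, 2 / ((n : ℝ) - i - 2) ≤ 2 * p / ((n : ℝ) - p - 1) := by
  have hpn' : (p : ℝ) + 3 ≤ n := by exact_mod_cast hpn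
  calc _ ≤ ∑ _i ∈ Finset.range p, 2 / ((n : ℝ) - p - 1) := by
        refine Finset.sum_le_sum fun i hi => ?_
        have hi' : (i : ℝ) + 1 ≤ p := by exact_mod_cast Finset.mem_range.1 hi
        exact div_le_div_of_nonneg_left (by norm_num) (by linarith) (by linarith)
    _ = _ := by
        rw [Finset.sum_const, Finset.card_range, nsmul_eq_mul]
        ring

/-- Each `1/m` is at most `log m - log (m - 1)`, and the sum telescopes to `2 log (n-2) - 2 log
(n-p-2)`. The second logarithm in the bound vanishes as `n - p → ∞`. -/
theorem variance_bound_le_log (hpn : p + 3 ≤ n) :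
    ∑ i ∈ Finset.range p, 2 / ((n : ℝ) - i - 2) ≤
      -2 * Real.log (1 - (p : ℝ) / n) + -2 * Real.log (1 - 2 / ((n : ℝ) - p)) := by
  have hpn' : (p : ℝ) + 3 ≤ n := by exact_mod_cast hpn
  have hp : (0 : ℝ) ≤ p := p.cast_nonneg
  have hn : (0 : ℝ) < n := by linarith
  have h1 : ∑ i ∈ Finset.range p, 2 / ((n : ℝ) - i - 2) ≤
      ∑ i ∈ Finset.range p,
        (2 * Real.log ((n : ℝ) - i - 2) - 2 * Real.log ((n : ℝ) - (i + 1 : ℕ) - 2)) := by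
    refine Finset.sum_le_sum fun i hi => ?_
    have hi' : (i : ℝ) + 1 ≤ p := by exact_mod_cast Finset.mem_range.1 hi
    have hm : (0 : ℝ) < (n : ℝ) - i - 2 := by linarith
    have hm' : (0 : ℝ) < (n : ℝ) - (i + 1 : ℕ) - 2 := by push_cast; linarith
    have h := Real.log_le_sub_one_of_pos (div_pos hm' hm)
    rw [Real.log_div hm'.ne' hm.ne'] at h
    have h2 : ((n : ℝ) - (i + 1 : ℕ) - 2) / ((n : ℝ) - i - 2) - 1 = -(2 / ((n : ℝ) - i - 2)) / 2 := by
      push_cast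
      field_simp
      ring
    rw [h2] at h
    linarith
  rw [Finset.sum_range_sub' (fun i : ℕ => 2 * Real.log ((n : ℝ) - i - 2))] at h1
  have h3 : Real.log ((n : ℝ) - 2) ≤ Real.log n :=
    Real.log_le_log (by linarith) (by linarith)
  have h4 : 1 - (p : ℝ) / n = ((n : ℝ) - p) / n := by field_simp
  have h6 : (n : ℝ) - p ≠ 0 := by linarith
  have h5 : 1 - 2 / ((n : ℝ) - p) = ((n : ℝ) - p - 2) / ((n : ℝ) - p) := by field_simp
  rw [h4, h5, Real.log_div (by linarith) hn.ne', Real.log_div (by linarith) (by linarith)]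
  simp only [Nat.cast_zero, sub_zero] at h1
  linarith

theorem tendsto_two_mul_div_add_three :
    Tendsto (fun n : ℕ => 2 * (n : ℝ) / (n + 3)) atTop (𝓝 2) := by
  have h := (tendsto_natCast_div_add_atTop (𝕜 := ℝ) 3).const_mul 2
  simpa [mul_div_assoc] using h

theorem tendsto_div_sub {p : ℕ → ℕ}
    (h0 : Tendsto (fun n : ℕ => (p n : ℝ) / (n : ℝ)) atTop (𝓝 0)) (c : ℝ) :
    Tendsto (fun n : ℕ => ((n : ℝ) + c) / ((n : ℝ) - p n - 1)) atTop (𝓝 1) := by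
  have h1 : Tendsto (fun n : ℕ => (1 + c / (n : ℝ)) / (1 - (p n : ℝ) / n - 1 / n)) atTop (𝓝 1) := by
    have := ((tendsto_const_div_atTop_nhds_zero_nat c).const_add 1).div
      ((h0.const_sub 1).sub (tendsto_const_div_atTop_nhds_zero_nat (1 : ℝ))) (by norm_num)
    simpa [Pi.div_def] using this
  refine h1.congr' ?_
  filter_upwards [eventually_gt_atTop 0] with n hn
  have hn' : (n : ℝ) ≠ 0 := by positivity
  rw [← mul_div_mul_left _ _ hn']
  congr 1 <;> field_simp

theorem eventually_gap {p : ℕ → ℕ}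
    (hnp : Tendsto (fun n : ℕ => (n : ℝ) - (p n : ℝ)) atTop atTop) :
    ∀ᶠ n in atTop, p n + 3 ≤ n := by
  filter_upwards [hnp.eventually_ge_atTop 3] with n hn
  have : (p n : ℝ) + 3 ≤ n := by linarith
  exact_mod_cast this

end Asymptotics

end LogDet

theorem theorem4 (p : ℕ → ℕ) (hp : ∀ n, 1 ≤ n → 1 ≤ p n ∧ p n ≤ n)
    (hnp : Tendsto (fun n : ℕ => (n : ℝ) - (p n : ℝ)) atTop atTop)
    (M : ∀ n, Set (EuclideanSpace ℝ (Fin (p n)))) (hM : ∀ n, (M n).Nonempty) :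
    (2 * liminf (fun n : ℕ => ENNReal.ofReal ((p n : ℝ) / (n : ℝ))) atTop
        ≤ liminf (fun n => LogDet.minimaxRisk n (p n) (M n)) atTop ∧
      liminf (fun n => LogDet.minimaxRisk n (p n) (M n)) atTop
        ≤ limsup (fun n => LogDet.minimaxRisk n (p n) (M n)) atTop ∧
      limsup (fun n => LogDet.minimaxRisk n (p n) (M n)) atTop
        ≤ limsup (fun n : ℕ => ENNReal.ofReal (-2 * Real.log (1 - (p n : ℝ) / (n : ℝ)))) atTop) ∧
    (Tendsto (fun n : ℕ => (p n : ℝ) / (n : ℝ)) atTop (𝓝 0) →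
      Tendsto (fun n : ℕ => ENNReal.ofReal ((n : ℝ) / (p n : ℝ)) * LogDet.minimaxRisk n (p n) (M n))
        atTop (𝓝 2) ∧
      LogDet.IsAsymptoticallySharpMinimax p M (fun n => LogDet.estimator n (p n))) := by
  have hgap := LogDet.eventually_gap hnp
  have hpos : ∀ᶠ n in atTop, 0 < p n := by
    filter_upwards [eventually_ge_atTop 1] with n hn using (hp n hn).1
  have hlow : ∀ᶠ n : ℕ in atTop, ENNReal.ofReal (2 * (p n : ℝ) / (n + 3)) ≤
      LogDet.minimaxRisk n (p n) (M n) := by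
    filter_upwards [hpos] with n hn
    exact (ENNReal.ofReal_le_ofReal (LogDet.le_scalar_bound hn)).trans
      (LogDet.le_minimaxRisk hn (hM n))
  have hup : ∀ᶠ n : ℕ in atTop, LogDet.maxRisk (M n) (LogDet.estimator n (p n)) ≤
      ENNReal.ofReal (2 * (p n : ℝ) / ((n : ℝ) - p n - 1)) := by
    filter_upwards [hgap] with n hn
    exact (LogDet.maxRisk_estimator_le (by omega) _).trans
      (ENNReal.ofReal_le_ofReal (LogDet.variance_bound_le hn))
  have htwo : Tendsto (fun n : ℕ => ENNReal.ofReal (2 * (n : ℝ) / (n + 3))) atTop (𝓝 2) := by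
    simpa using ENNReal.tendsto_ofReal LogDet.tendsto_two_mul_div_add_three
  refine ⟨⟨?_, liminf_le_limsup, ?_⟩, fun h0 => ⟨?_, fun n => LogDet.measurable_estimator, ?_⟩⟩
  -- The lower bound `2p/(n+3)` factors as `2n/(n+3)`, which tends to `2`, times `p/n`; a product of
  -- liminfs is at most the liminf of the product.
  · calc 2 * liminf (fun n : ℕ => ENNReal.ofReal ((p n : ℝ) / (n : ℝ))) atTop
        = liminf (fun n : ℕ => ENNReal.ofReal (2 * (n : ℝ) / (n + 3))) atTop *
          liminf (fun n : ℕ => ENNReal.ofReal ((p n : ℝ) / (n : ℝ))) atTop := by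
          rw [htwo.liminf_eq]
      _ ≤ _ := ENNReal.le_liminf_mul
      _ ≤ _ := by
          refine liminf_le_liminf ?_
          filter_upwards [hlow, eventually_gt_atTop 0] with n hn hn0
          refine le_trans (le_of_eq ?_) hn
          rw [Pi.mul_apply, ← ENNReal.ofReal_mul (by positivity)]
          have hn' : (0 : ℝ) < n := by exact_mod_cast hn0
          congr 1
          field_simp
  · have hδ : Tendsto (fun n : ℕ => ENNReal.ofReal (-2 * Real.log (1 - 2 / ((n : ℝ) - p n))))
        atTop (𝓝 0) := by
      have h1 : Tendsto (fun n : ℕ => 1 - 2 / ((n : ℝ) - p n)) atTop (𝓝 1) := by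
        simpa using (hnp.const_div_atTop 2).const_sub 1
      have h2 := (((Real.continuousAt_log one_ne_zero).tendsto.comp h1).const_mul (-2))
      simpa using ENNReal.tendsto_ofReal h2
    rw [← ENNReal.limsup_add_of_right_tendsto_zero hδ
      (fun n : ℕ => ENNReal.ofReal (-2 * Real.log (1 - (p n : ℝ) / (n : ℝ))))]
    refine limsup_le_limsup ?_
    filter_upwards [hgap] with n hn
    exact (LogDet.minimaxRisk_le_maxRisk_estimator _).trans
      ((LogDet.maxRisk_estimator_le (by omega) _).trans
        ((ENNReal.ofReal_le_ofReal (LogDet.variance_bound_le_log hn)).trans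
          ENNReal.ofReal_add_le))
  · have hU : Tendsto (fun n : ℕ => ENNReal.ofReal (2 * (((n : ℝ) + 0) / ((n : ℝ) - p n - 1))))
        atTop (𝓝 2) := by
      simpa using ENNReal.tendsto_ofReal ((LogDet.tendsto_div_sub h0 0).const_mul 2)
    refine tendsto_of_tendsto_of_tendsto_of_le_of_le' htwo hU ?_ ?_
    · filter_upwards [hlow, hpos] with n hn hp0
      have hp' : (0 : ℝ) < p n := by exact_mod_cast hp0
      calc _ = ENNReal.ofReal ((n : ℝ) / p n) * ENNReal.ofReal (2 * (p n : ℝ) / (n + 3)) := by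
            rw [← ENNReal.ofReal_mul (by positivity)]
            congr 1
            field_simp
        _ ≤ _ := by gcongr
    · filter_upwards [hup, hpos] with n hn hp0
      have hp' : (0 : ℝ) < p n := by exact_mod_cast hp0
      calc _ ≤ ENNReal.ofReal ((n : ℝ) / p n) *
              ENNReal.ofReal (2 * (p n : ℝ) / ((n : ℝ) - p n - 1)) := by
            gcongr
            exact (LogDet.minimaxRisk_le_maxRisk_estimator _).trans hn
        _ = _ := by
            rw [← ENNReal.ofReal_mul (by positivity)]
            congr 1
            field_simp
            ring
  · have hU : Tendsto (fun n : ℕ => ENNReal.ofReal (((n : ℝ) + 3) / ((n : ℝ) - p n - 1)))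
        atTop (𝓝 1) := by
      simpa using ENNReal.tendsto_ofReal (LogDet.tendsto_div_sub h0 3)
    -- The ratio is at least `1` once the minimax risk is known to be positive and finite, and at
    -- most the quotient of the two bounds, in which `2p` cancels.
    refine tendsto_of_tendsto_of_tendsto_of_le_of_le' tendsto_const_nhds hU ?_ ?_
    · filter_upwards [hlow, hup, hpos] with n hl hu hp0
      have hp' : (0 : ℝ) < p n := by exact_mod_cast hp0
      have hle := LogDet.minimaxRisk_le_maxRisk_estimator (n := n) (M n)
      have hne : LogDet.minimaxRisk n (p n) (M n) ≠ 0 :=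
        ((ENNReal.ofReal_pos.2 (by positivity)).trans_le hl).ne'
      have htop : LogDet.minimaxRisk n (p n) (M n) ≠ ⊤ :=
        ((hle.trans hu).trans_lt ENNReal.ofReal_lt_top).ne
      rw [ENNReal.le_div_iff_mul_le (Or.inl hne) (Or.inl htop), one_mul]
      exact hle
    · filter_upwards [hlow, hup, hpos] with n hl hu hp0
      have hp' : (0 : ℝ) < p n := by exact_mod_cast hp0
      refine (ENNReal.div_le_div hu hl).trans_eq ?_
      rw [← ENNReal.ofReal_div_of_pos (by positivity)]
      congr 1
      field_simp
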